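/- Let $\{B(t):t\in\mathbb R\}$ be a standard two-sided Brownian motion with almost surely continuous paths on a probability space (that is, $\{B(t)\}_{t\ge0}$ and $\{B(-t)\}_{t\ge0}$ are two independent standard Brownian motions), and let $\mathbb R_+=[0,\infty)$. For $H\in(0,1)$ and $t\in\mathbb R_+$ put $$f_H(t,s)=(t-s)^{H-\frac12}-(-s)^{H-\frac12}\quad(s<0),\qquad g_H(t,s)=(t-s)^{H-\frac12}\quad(0\le s<t),$$ and for an integer $n\ge0$ let $f_H^{(n)}(t,s)=\frac{\partial^n}{\partial H^n}f_H(t,s)$ and $g_H^{(n)}(t,s)=\frac{\partial^n}{\partial H^n}g_H(t,s)$. Define the field $$\tilde X^{(n)}_H(t)=-\int_{-\infty}^0\Big[\frac{\partial}{\partial s}f^{(n)}_H(t,s)\Big]B(s)\,ds+g^{(n)}_H(t,0)B(t)+\int_0^t\Big[\frac{\partial}{\partial s}g^{(n)}_H(t,s)\Big]\big(B(t)-B(s)\big)\,ds,$$ where for $t=0$ the second term is read as a multiple of $B(0)$, hence as $0$ almost surely (as $B(0)=0$ almost surely). **Proposition.** For every integer $n\ge0$, almost surely, both integrals above converge absolutely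 for all $(H,t)\in(0,1)\times\mathbb R_+$, and the map $(H,t)\mapsto\tilde X^{(n)}_H(t)$ is jointly continuous on $(0,1)\times\mathbb R_+$. -/

import Mathlib

open MeasureTheory ProbabilityTheory Set
open scoped NNReal

noncomputable section

/-- A standard two-sided Brownian motion (Wiener process) `B = (B t)_{t ∈ ℝ}` on `(Ω, P)`:
`(B t)_{t ≥ 0}` and `(B (-t))_{t ≥ 0}` are two independent standard Brownian motions. -/
structure IsTwoSidedBrownian {Ω : Type*} [MeasurableSpace Ω] (B : ℝ → Ω → ℝ) (P : Measure Ω) :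
    Prop where
  pos : IsBrownianReal (fun (t : ℝ≥0) (ω : Ω) => B (t : ℝ) ω) P
  neg : IsBrownianReal (fun (t : ℝ≥0) (ω : Ω) => B (-(t : ℝ)) ω) P
  indep : IndepFun (fun (ω : Ω) (t : ℝ≥0) => B (t : ℝ) ω)
    (fun (ω : Ω) (t : ℝ≥0) => B (-(t : ℝ)) ω) P

/-- The kernel `f_H(t,s) = (t-s)^{H-1/2} - (-s)^{H-1/2}`, used for `s < 0 ≤ t`. -/
def fKer (H t s : ℝ) : ℝ := (t - s) ^ (H - 1 / 2) - (-s) ^ (H - 1 / 2)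

/-- The kernel `g_H(t,s) = (t-s)^{H-1/2}`, used for `0 ≤ s < t`. -/
def gKer (H t s : ℝ) : ℝ := (t - s) ^ (H - 1 / 2)

/-- `f_H^{(n)}(t,s) = ∂ⁿ/∂Hⁿ f_H(t,s)`. -/
def fKerD (n : ℕ) (H t s : ℝ) : ℝ := iteratedDeriv n (fun h => fKer h t s) H

/-- `g_H^{(n)}(t,s) = ∂ⁿ/∂Hⁿ g_H(t,s)`. -/
def gKerD (n : ℕ) (H t s : ℝ) : ℝ := iteratedDeriv n (fun h => gKer h t s) H

/-- The integrand `[∂/∂s f_H^{(n)}(t,s)] b(s)` of the integral over the negative half-line,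
for a path `b : ℝ → ℝ`. -/
def pwzNegIntegrand (b : ℝ → ℝ) (n : ℕ) (H t s : ℝ) : ℝ :=
  deriv (fun r => fKerD n H t r) s * b s

/-- The integrand `[∂/∂s g_H^{(n)}(t,s)] (b(t) - b(s))` of the integral over `(0,t)`,
for a path `b : ℝ → ℝ`. -/
def pwzPosIntegrand (b : ℝ → ℝ) (n : ℕ) (H t s : ℝ) : ℝ :=
  deriv (fun r => gKerD n H t r) s * (b t - b s)

/-- The Paley-Wiener-Zygmund representation of the `n`-th derivative of the Mandelbrot-van Ness
field, evaluated at a path `b : ℝ → ℝ` of the driving Brownian motion: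
`-∫_{-∞}^0 [∂_s f_H^{(n)}(t,s)] b(s) ds + g_H^{(n)}(t,0) b(t)
  + ∫_0^t [∂_s g_H^{(n)}(t,s)] (b(t) - b(s)) ds`.
For `t = 0` the middle term is a multiple of `b 0`, which vanishes for almost every path. -/
def pwzField (b : ℝ → ℝ) (n : ℕ) (H t : ℝ) : ℝ :=
  -(∫ s in Iio (0 : ℝ), pwzNegIntegrand b n H t s) + gKerD n H t 0 * b t
    + ∫ s in Ioo (0 : ℝ) t, pwzPosIntegrand b n H t s

end

/-! The exceptional null set must not depend on `(H, t)`, so all the probability is put into one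
property of paths, `IsHolderHalfPath`, which holds almost surely for both halves of `B`: Hölder
continuity of every order `1/2 - ε`, with a constant on `[0, T]` growing at most like `T ^ (2ε)`. It
follows from the Gaussian moments of dyadic increments, summed over all scales and all lengths at
once.

The rest is deterministic. With `γ = H - 1/2`, differentiating the kernels `n` times in `H` turns `x
^ γ` into `x ^ γ (log x) ^ n`, and the logarithms cost only a factor `x ^ δ + x ^ (-δ)` with `δ`
arbitrarily small. There are three critical places. At `s = 0⁻` and `s = t⁻` the kernel's derivative
is at worst about `x ^ (H - 3/2)` in the distance `x`, and the path or its increment contributes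
about `x ^ (1/2)`: the product is integrable because `H > 0`. At `s = -∞` the difference of the two
terms of `f_H` gains a power, leaving `x ^ (H - 5/2)` against a path of size about `x ^ (1/2)`:
integrable because `H < 1`. These majorants are uniform for `H` in compact subintervals of `(0, 1)`
and bounded `t`, so dominated convergence gives joint continuity of the integrals. The boundary term
is about `t ^ (H - 1/2) t ^ (1/2)`, hence tends to `0` as `t → 0`. -/

/-! ### Moments of Brownian increments -/

theorem lintegral_enorm_pow_gaussianReal (v : ℝ≥0) (p : ℕ) :
    ∫⁻ x, ‖x‖ₑ ^ (2 * p) ∂gaussianReal 0 v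
      = (v : ENNReal) ^ p * ∫⁻ x, ‖x‖ₑ ^ (2 * p) ∂gaussianReal 0 1 := by
  have h : gaussianReal 0 v = (gaussianReal 0 1).map (fun x => √(v : ℝ) * x) := by
    rw [gaussianReal_map_const_mul]
    congr 1
    · simp
    · ext; simp
  rw [h, lintegral_map (by fun_prop) (by fun_prop), ← lintegral_const_mul _ (by fun_prop)]
  refine lintegral_congr fun x => ?_
  rw [enorm_mul, mul_pow]
  congr 1
  rw [pow_mul, Real.enorm_eq_ofReal (Real.sqrt_nonneg _), ← ENNReal.ofReal_pow (Real.sqrt_nonneg _),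
    Real.sq_sqrt (NNReal.coe_nonneg v), ENNReal.ofReal_coe_nnreal]

theorem lintegral_enorm_pow_gaussianReal_ne_top (p : ℕ) :
    ∫⁻ x, ‖x‖ₑ ^ (2 * p) ∂gaussianReal 0 1 ≠ ⊤ := by
  rcases Nat.eq_zero_or_pos p with rfl | hp
  · simp
  have h := (memLp_id_gaussianReal (μ := 0) (v := 1) ((2 * p : ℕ) : ℝ≥0)).eLpNorm_ne_top
  have h0 : (2 * p : ℕ) ≠ 0 := by omega
  have := (eLpNorm_lt_top_iff_lintegral_rpow_enorm_lt_top (p := ((2 * p : ℕ) : ENNReal))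
    (by exact_mod_cast h0) (ENNReal.natCast_ne_top _)).1
    (lt_top_iff_ne_top.2 (by simpa using h))
  refine (lt_of_le_of_lt (le_of_eq ?_) this).ne
  refine lintegral_congr fun x => ?_
  rw [ENNReal.toReal_natCast, ENNReal.rpow_natCast, id]

theorem ProbabilityTheory.IsPreBrownianReal.lintegral_enorm_sub_pow {Ω : Type*} [MeasurableSpace Ω]
    {P : Measure Ω} {X : ℝ≥0 → Ω → ℝ} (hX : IsPreBrownianReal X P) (s t : ℝ≥0) (p : ℕ) :
    ∫⁻ ω, ‖X s ω - X t ω‖ₑ ^ (2 * p) ∂P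
      = (nndist (s : ℝ) t : ENNReal) ^ p * ∫⁻ x, ‖x‖ₑ ^ (2 * p) ∂gaussianReal 0 1 := by
  have h := hX.hasLaw_sub s t
  rw [← lintegral_enorm_pow_gaussianReal]
  refine Eq.trans ?_ (congrArg (fun μ : Measure ℝ => ∫⁻ x, ‖x‖ₑ ^ (2 * p) ∂μ) h.map_eq)
  rw [lintegral_map' (by fun_prop) h.aemeasurable]
  rfl

/-! ### Hölder regularity and growth of almost every path -/

/-- If the increments of `v` over the dyadic intervals of length `2⁻ᵐ` are at most `A 2 ^ (-α m)`,
then `v` is Hölder continuous with exponent `α`. -/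
theorem holder_of_dyadic_increments {α : ℝ} (hα : 0 < α) :
    ∃ K : ℝ, 0 ≤ K ∧ ∀ (v : ℝ → ℝ) (A : ℝ), 0 ≤ A → ContinuousOn v (Icc 0 1) →
      (∀ m k : ℕ, k < 2 ^ m →
        |v ((k + 1 : ℕ) / 2 ^ m) - v (k / 2 ^ m)| ≤ A * ((2 : ℝ) ^ (-α)) ^ m) →
      ∀ s ∈ Icc (0 : ℝ) 1, ∀ t ∈ Icc (0 : ℝ) 1, |v t - v s| ≤ K * A * |t - s| ^ α := by
  set r : ℝ := (2 : ℝ) ^ (-α) with hr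
  have hr0 : 0 < r := by positivity
  have hr1 : r < 1 := Real.rpow_lt_one_of_one_lt_of_neg (by norm_num) (by linarith)
  have h1r : 0 < 1 - r := by linarith
  -- Two geometric tails `r / (1 - r)`, one for each endpoint, and one middle increment; the outer
  -- `1 / r` comes from `r ^ (m + 1) ≤ |t - s| ^ α`.
  refine ⟨(1 + 2 * r / (1 - r)) / r, by positivity, fun v A hA hv hinc => ?_⟩
  have fl (t : ℝ) (ht : t ∈ Icc (0 : ℝ) 1) (m : ℕ) :
      (⌊t * 2 ^ m⌋₊ : ℝ) / 2 ^ m ∈ Icc (0 : ℝ) 1 ∧ |(⌊t * 2 ^ m⌋₊ : ℝ) / 2 ^ m - t| ≤ (1 / 2) ^ m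
        ∧ ⌊t * 2 ^ m⌋₊ ≤ 2 ^ m := by
    have h2 : (0 : ℝ) < 2 ^ m := by positivity
    have h3 : 0 ≤ t * 2 ^ m := mul_nonneg ht.1 h2.le
    have h4 := Nat.floor_le h3
    have h5 := Nat.lt_floor_add_one (t * 2 ^ m)
    have h6 : t * 2 ^ m ≤ 2 ^ m := by nlinarith [ht.2]
    refine ⟨⟨by positivity, by rw [div_le_one h2]; linarith⟩, ?_, ?_⟩
    · rw [div_sub' h2.ne', abs_div, abs_of_pos h2, one_div_pow, div_le_div_iff_of_pos_right h2]
      rw [abs_le]; constructor <;> linarith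
    · have : (⌊t * 2 ^ m⌋₊ : ℝ) ≤ ((2 ^ m : ℕ) : ℝ) := by push_cast; linarith
      exact_mod_cast this
  -- Chaining: the dyadic floors of `t` at levels `m` and `m + 1` agree or differ by one interval of
  -- level `m + 1`, so the increments form a geometric series, whose limit is `v t` by continuity.
  have key (t : ℝ) (ht : t ∈ Icc (0 : ℝ) 1) (m : ℕ) :
      dist (v (⌊t * 2 ^ m⌋₊ / 2 ^ m)) (v t) ≤ (A * r) * r ^ m / (1 - r) := by
    refine dist_le_of_le_geometric_of_tendsto r (A * r) hr1 (f := fun m : ℕ =>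
      v (⌊t * 2 ^ m⌋₊ / 2 ^ m)) (fun m => ?_) ?_ m
    · have e1 : t * 2 ^ (m + 1) = 2 * (t * 2 ^ m) := by ring
      have h3 : 0 ≤ t * 2 ^ m := mul_nonneg ht.1 (by positivity)
      have h4 := Nat.floor_le h3
      have h5 := Nat.lt_floor_add_one (t * 2 ^ m)
      set k := ⌊t * 2 ^ m⌋₊ with hk
      have h6 : 2 * k ≤ ⌊t * 2 ^ (m + 1)⌋₊ := Nat.le_floor (by push_cast; linarith)
      have h7 : ⌊t * 2 ^ (m + 1)⌋₊ < 2 * k + 2 :=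
        (Nat.floor_lt (by linarith)).2 (by push_cast; linarith)
      have e2 : (k : ℝ) / 2 ^ m = (2 * k : ℕ) / 2 ^ (m + 1) := by
        push_cast; rw [pow_succ]; field_simp
      have h8 := (fl t ht (m + 1)).2.2
      rw [e2]
      obtain h | h : ⌊t * 2 ^ (m + 1)⌋₊ = 2 * k ∨ ⌊t * 2 ^ (m + 1)⌋₊ = 2 * k + 1 := by omega
      · rw [h, dist_self]; positivity
      · rw [h, dist_comm, Real.dist_eq, mul_assoc, ← pow_succ']
        exact hinc (m + 1) (2 * k) (by omega)
    · refine (hv t ht).tendsto.comp ?_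
      refine tendsto_nhdsWithin_iff.2 ⟨?_, Filter.Eventually.of_forall fun m => (fl t ht m).1⟩
      refine tendsto_iff_dist_tendsto_zero.2 (squeeze_zero (fun _ => dist_nonneg)
        (fun m => (fl t ht m).2.1) (tendsto_pow_atTop_nhds_zero_of_lt_one (by norm_num) (by norm_num)))
  have main : ∀ s ∈ Icc (0 : ℝ) 1, ∀ t ∈ Icc (0 : ℝ) 1, s < t →
      |v t - v s| ≤ (1 + 2 * r / (1 - r)) / r * A * |t - s| ^ α := by
    intro s hs t ht hst
    have hd : 0 < t - s := by linarith
    -- The level with `2⁻⁽ᵐ⁺¹⁾ < t - s ≤ 2⁻ᵐ`, at which the floors of `s` and `t` are at most one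
    -- step apart.
    obtain ⟨m, hm1, hm2⟩ := exists_nat_pow_near_of_lt_one hd (by linarith [hs.1, ht.2] : t - s ≤ 1)
      (by norm_num : (0 : ℝ) < 1 / 2) (by norm_num)
    have h2 : (0 : ℝ) < 2 ^ m := by positivity
    have hs0 : 0 ≤ s * 2 ^ m := mul_nonneg hs.1 h2.le
    have hlen : t * 2 ^ m ≤ s * 2 ^ m + 1 := by
      rw [one_div_pow, le_div_iff₀ h2] at hm2; linarith
    have h6 : ⌊s * 2 ^ m⌋₊ ≤ ⌊t * 2 ^ m⌋₊ := Nat.floor_mono (by nlinarith)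
    have h7 : ⌊t * 2 ^ m⌋₊ ≤ ⌊s * 2 ^ m⌋₊ + 1 := by
      rw [← Nat.floor_add_one hs0]; exact Nat.floor_mono hlen
    have h8 := (fl t ht m).2.2
    have mid : dist (v (⌊s * 2 ^ m⌋₊ / 2 ^ m)) (v (⌊t * 2 ^ m⌋₊ / 2 ^ m)) ≤ A * r ^ m := by
      obtain h | h : ⌊t * 2 ^ m⌋₊ = ⌊s * 2 ^ m⌋₊ ∨ ⌊t * 2 ^ m⌋₊ = ⌊s * 2 ^ m⌋₊ + 1 := by omega
      · rw [h, dist_self]; positivity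
      · rw [h, dist_comm, Real.dist_eq]
        exact hinc m _ (by omega)
    have hrm : r ^ m ≤ |t - s| ^ α / r := by
      rw [le_div_iff₀ hr0, ← pow_succ, abs_of_pos hd]
      have : r ^ (m + 1) = ((1 / 2 : ℝ) ^ (m + 1)) ^ α := by
        rw [hr, Real.rpow_neg (by norm_num), ← Real.inv_rpow (by norm_num), one_div,
          ← Real.rpow_natCast, ← Real.rpow_natCast, ← Real.rpow_mul (by norm_num),
          ← Real.rpow_mul (by norm_num), mul_comm]
      rw [this]
      exact Real.rpow_le_rpow (by positivity) hm1.le hα.le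
    calc |v t - v s| = dist (v s) (v t) := by rw [dist_comm, Real.dist_eq]
      _ ≤ dist (v (⌊s * 2 ^ m⌋₊ / 2 ^ m)) (v s) + dist (v (⌊s * 2 ^ m⌋₊ / 2 ^ m))
            (v (⌊t * 2 ^ m⌋₊ / 2 ^ m)) + dist (v (⌊t * 2 ^ m⌋₊ / 2 ^ m)) (v t) := by
          rw [dist_comm _ (v s)]; exact dist_triangle4 _ _ _ _
      _ ≤ (A * r) * r ^ m / (1 - r) + A * r ^ m + (A * r) * r ^ m / (1 - r) :=
          add_le_add (add_le_add (key s hs m) mid) (key t ht m)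
      _ = (1 + 2 * r / (1 - r)) * A * r ^ m := by field_simp; ring
      _ ≤ (1 + 2 * r / (1 - r)) * A * (|t - s| ^ α / r) := by gcongr
      _ = _ := by ring
  intro s hs t ht
  rcases lt_trichotomy s t with h | h | h
  · exact main s hs t ht h
  · subst h; simp only [sub_self, abs_zero]; positivity
  · rw [abs_sub_comm, abs_sub_comm t]; exact main t ht s hs h

/-- A path on `[0, ∞)` which starts at `0`, is Hölder continuous of every order below `1 / 2`, with
constants that grow slower than any power of the length of the interval. -/
structure IsHolderHalfPath (w : ℝ → ℝ) : Prop where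
  zero : w 0 = 0
  cont : ContinuousOn w (Ici 0)
  holder : ∀ ε : ℝ, 0 < ε → ε < 1 / 2 → ∃ C : ℝ, 0 ≤ C ∧ ∀ T : ℝ, 1 ≤ T → ∀ s ∈ Icc 0 T,
    ∀ t ∈ Icc 0 T, |w t - w s| ≤ C * T ^ (2 * ε) * |t - s| ^ (1 / 2 - ε)

/-- Give each increment's `2 (q + 2)`-th power the reciprocal `wt` of the claimed bound and sum over
all `N`, `m`, `k`. The `2 ^ m` increments at `(N, m)` have moment `(2 ^ N / 2 ^ m) ^ (q + 2) * M`
each, so their total weighted expectation is `4⁻ᴺ 2⁻ᵐ M`. This is summable, so the random sum is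
almost surely finite and serves as `S`. -/
theorem ProbabilityTheory.IsPreBrownianReal.ae_exists_dyadic_increments_le {Ω : Type*}
    [MeasurableSpace Ω] {P : Measure Ω} {B : ℝ → Ω → ℝ}
    (hB : IsPreBrownianReal (fun (t : ℝ≥0) ω => B t ω) P) (q : ℕ) :
    ∀ᵐ ω ∂P, ∃ S : ℝ, 0 ≤ S ∧ ∀ N m k : ℕ, k < 2 ^ m →
      |B (2 ^ N * ((k + 1 : ℕ) / 2 ^ m)) ω - B (2 ^ N * (k / 2 ^ m)) ω| ^ (2 * (q + 2))
        ≤ S * ((2 ^ N) ^ (q + 4) / (2 ^ m) ^ q) := by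
  set M := ∫⁻ x, ‖x‖ₑ ^ (2 * (q + 2)) ∂gaussianReal 0 1 with hM
  have hMt : M ≠ ⊤ := lintegral_enorm_pow_gaussianReal_ne_top _
  let wt : ℕ × ℕ → ℝ := fun i => (2 ^ i.2) ^ q / (2 ^ i.1) ^ (q + 4)
  have hwt : ∀ i, 0 < wt i := fun i => by positivity
  let D : ℕ × ℕ → ℕ → Ω → ENNReal := fun i k ω =>
    ‖B (2 ^ i.1 * ((k + 1 : ℕ) / 2 ^ i.2)) ω - B (2 ^ i.1 * (k / 2 ^ i.2)) ω‖ₑ ^ (2 * (q + 2))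
  have hpt : ∀ (i : ℕ × ℕ) (k : ℕ),
      ∃ z : ℝ≥0, (z : ℝ) = 2 ^ i.1 * (k / 2 ^ i.2) := fun i k => ⟨⟨_, by positivity⟩, rfl⟩
  have hmeas : ∀ i k, AEMeasurable (D i k) P := fun i k => by
    obtain ⟨z, hz⟩ := hpt i k
    obtain ⟨z', hz'⟩ := hpt i (k + 1)
    simp only [D, ← hz, ← hz']
    exact (((hB.aemeasurable z').sub (hB.aemeasurable z)).enorm).pow_const _
  have hint : ∀ i k, ∫⁻ ω, D i k ω ∂P = ENNReal.ofReal ((2 ^ i.1 / 2 ^ i.2) ^ (q + 2)) * M := by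
    intro i k
    obtain ⟨z, hz⟩ := hpt i k
    obtain ⟨z', hz'⟩ := hpt i (k + 1)
    simp only [D, ← hz, ← hz']
    rw [hB.lintegral_enorm_sub_pow z' z (q + 2), ENNReal.ofReal_pow (by positivity)]
    congr 2
    rw [← ENNReal.ofReal_coe_nnreal, coe_nndist, Real.dist_eq, hz, hz']
    congr 1
    push_cast
    rw [← mul_sub, ← sub_div, add_sub_cancel_left, abs_of_nonneg (by positivity), mul_one_div]
  have hfin : ∫⁻ ω, ∑' i, ∑ k ∈ Finset.range (2 ^ i.2), ENNReal.ofReal (wt i) * D i k ω ∂P ≠ ⊤ := by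
    rw [lintegral_tsum (fun i => Finset.aemeasurable_fun_sum _ fun k _ => (hmeas i k).const_mul _)]
    have : ∀ i : ℕ × ℕ, ∫⁻ ω, ∑ k ∈ Finset.range (2 ^ i.2), ENNReal.ofReal (wt i) * D i k ω ∂P
        = ENNReal.ofReal ((1 / 4) ^ i.1 * (1 / 2) ^ i.2) * M := by
      intro i
      rw [lintegral_finsetSum' _ fun k _ => (hmeas i k).const_mul _]
      simp_rw [lintegral_const_mul'' _ (hmeas i _), hint]
      rw [Finset.sum_const, Finset.card_range, nsmul_eq_mul, ← mul_assoc, ← mul_assoc]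
      congr 1
      rw [← ENNReal.ofReal_natCast, ← ENNReal.ofReal_mul (by positivity),
        ← ENNReal.ofReal_mul (by positivity)]
      congr 1
      have h4 : (1 / 4 : ℝ) ^ i.1 = 1 / (2 ^ i.1) ^ 2 := by
        rw [one_div_pow, ← pow_mul, mul_comm, pow_mul]; norm_num
      simp only [wt, h4, one_div_pow]
      push_cast
      have : (0 : ℝ) < 2 ^ i.1 := by positivity
      have : (0 : ℝ) < 2 ^ i.2 := by positivity
      generalize (2 : ℝ) ^ i.1 = a at *
      generalize (2 : ℝ) ^ i.2 = b at *
      rw [div_pow]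
      field_simp
      ring
    simp_rw [this]
    rw [ENNReal.tsum_mul_right]
    refine ENNReal.mul_ne_top ?_ hMt
    refine Summable.tsum_ofReal_ne_top ?_
    exact (summable_geometric_of_lt_one (by norm_num) (by norm_num)).mul_of_nonneg
      (summable_geometric_of_lt_one (by norm_num) (by norm_num)) (fun _ => by positivity)
      (fun _ => by positivity)
  have hae := ae_lt_top' (AEMeasurable.tsum fun i =>
    Finset.aemeasurable_fun_sum _ fun k _ => (hmeas i k).const_mul _) hfin
  filter_upwards [hae] with ω hω
  set S := ∑' i, ∑ k ∈ Finset.range (2 ^ i.2), ENNReal.ofReal (wt i) * D i k ω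
  refine ⟨S.toReal, ENNReal.toReal_nonneg, fun N m k hk => ?_⟩
  have h1 : ENNReal.ofReal (wt (N, m)) * D (N, m) k ω ≤ S :=
    (Finset.single_le_sum (f := fun k => ENNReal.ofReal (wt (N, m)) * D (N, m) k ω)
      (fun _ _ => zero_le) (Finset.mem_range.2 hk)).trans
      (ENNReal.le_tsum (f := fun i : ℕ × ℕ => ∑ k ∈ Finset.range (2 ^ i.2),
        ENNReal.ofReal (wt i) * D i k ω) (N, m))
  have h2 := ENNReal.toReal_mono hω.ne h1
  simp only [D] at h2
  rw [ENNReal.toReal_mul, ENNReal.toReal_ofReal (hwt _).le, ENNReal.toReal_pow, toReal_enorm,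
    Real.norm_eq_abs] at h2
  have h3 : (2 ^ N : ℝ) ^ (q + 4) / (2 ^ m) ^ q = (wt (N, m))⁻¹ := by simp only [wt, inv_div]
  rw [h3, ← div_eq_mul_inv, le_div_iff₀ (hwt _), mul_comm]
  exact h2

/-- With `η = 1 / (q + 2)`, the `2 (q + 2)`-th root of the bound is a multiple of `2 ^ (N (1/2 + η))
* 2 ^ (-m (1/2 - η))`. Chaining on `[0, 1]` after rescaling by `c = 2 ^ (N + 1)`, which lies between
`T` and `2 T`, gives order `1/2 - η` with constant of size `T ^ (2η)`. -/
theorem isHolderHalfPath_of_dyadic_increments {w : ℝ → ℝ} (h0 : w 0 = 0)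
    (hc : ContinuousOn w (Ici 0))
    (h : ∀ q : ℕ, ∃ S : ℝ, 0 ≤ S ∧ ∀ N m k : ℕ, k < 2 ^ m →
      |w (2 ^ N * ((k + 1 : ℕ) / 2 ^ m)) - w (2 ^ N * (k / 2 ^ m))| ^ (2 * (q + 2))
        ≤ S * ((2 ^ N) ^ (q + 4) / (2 ^ m) ^ q)) : IsHolderHalfPath w := by
  refine ⟨h0, hc, fun ε hε hε2 => ?_⟩
  obtain ⟨q, hq⟩ : ∃ q : ℕ, 0 < q ∧ 1 / (q + 2 : ℝ) < ε := by
    obtain ⟨n, hn⟩ := exists_nat_one_div_lt hε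
    refine ⟨n + 1, by omega, lt_of_le_of_lt ?_ hn⟩
    push_cast
    exact one_div_le_one_div_of_le (by positivity) (by linarith)
  obtain ⟨hq0, hqε⟩ := hq
  obtain ⟨S, hS, hinc⟩ := h q
  set η : ℝ := 1 / (q + 2 : ℝ) with hη
  have hq0' : (0 : ℝ) < q := by exact_mod_cast hq0
  have hηpos : 0 < η := by positivity
  have hα : 0 < 1 / 2 - η := by linarith
  obtain ⟨K, hK, hold⟩ := holder_of_dyadic_increments hα
  set S' : ℝ := S ^ (η / 2) with hS'
  have hS'0 : 0 ≤ S' := Real.rpow_nonneg hS _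
  have root : ∀ N m k : ℕ, k < 2 ^ m →
      |w (2 ^ N * ((k + 1 : ℕ) / 2 ^ m)) - w (2 ^ N * (k / 2 ^ m))|
        ≤ S' * ((2 : ℝ) ^ N) ^ (1 / 2 + η) * ((2 : ℝ) ^ (-(1 / 2 - η))) ^ m := by
    intro N m k hk
    have h1 := Real.rpow_le_rpow (by positivity) (hinc N m k hk) (by positivity : 0 ≤ η / 2)
    have e0 : ((2 * (q + 2) : ℕ) : ℝ) * (η / 2) = 1 := by
      rw [hη]; push_cast; field_simp
    rw [← Real.rpow_natCast, ← Real.rpow_mul (abs_nonneg _), e0, Real.rpow_one,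
      Real.mul_rpow hS (by positivity), Real.div_rpow (by positivity) (by positivity)] at h1
    have eA : (((2 : ℝ) ^ N) ^ (q + 4)) ^ (η / 2) = ((2 : ℝ) ^ N) ^ (1 / 2 + η) := by
      rw [← Real.rpow_natCast (2 ^ N), ← Real.rpow_mul (by positivity)]
      congr 1
      rw [hη]; push_cast; field_simp; ring
    have eB : (((2 : ℝ) ^ m) ^ q) ^ (η / 2) = (((2 : ℝ) ^ (-(1 / 2 - η))) ^ m)⁻¹ := by
      rw [← Real.rpow_natCast, ← Real.rpow_natCast, ← Real.rpow_natCast,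
        ← Real.rpow_mul (by positivity), ← Real.rpow_mul (by positivity),
        ← Real.rpow_mul (by positivity), ← Real.rpow_neg (by positivity)]
      congr 1
      rw [hη]; field_simp; ring
    rw [eA, eB, div_inv_eq_mul, ← mul_assoc] at h1
    exact h1
  refine ⟨K * S' * 4, by positivity, fun T hT s hs t ht => ?_⟩
  have hT0 : 0 < T := by linarith
  obtain ⟨N, hN1, hN2⟩ := exists_nat_pow_near hT (by norm_num : (1 : ℝ) < 2)
  set c : ℝ := 2 ^ (N + 1) with hcdef
  have hcpos : 0 < c := by positivity
  have hc2 : c ≤ 2 * T := by rw [hcdef, pow_succ]; linarith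
  have mem : ∀ x ∈ Icc 0 T, x / c ∈ Icc (0 : ℝ) 1 := fun x hx =>
    ⟨div_nonneg hx.1 hcpos.le, by rw [div_le_one hcpos]; linarith [hx.2]⟩
  have h2 := hold (fun x => w (c * x)) (S' * c ^ (1 / 2 + η)) (by positivity)
    (hc.comp (by fun_prop) fun x hx => mul_nonneg hcpos.le hx.1)
    (fun m k hk => root (N + 1) m k hk) _ (mem s hs) _ (mem t ht)
  simp only [mul_div_cancel₀ _ hcpos.ne'] at h2
  rw [← sub_div, abs_div, abs_of_pos hcpos, Real.div_rpow (abs_nonneg _) hcpos.le] at h2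
  refine h2.trans ?_
  have e1 : K * (S' * c ^ (1 / 2 + η)) * (|t - s| ^ (1 / 2 - η) / c ^ (1 / 2 - η))
      = K * S' * c ^ (2 * η) * |t - s| ^ (1 / 2 - η) := by
    have : c ^ (1 / 2 + η) = c ^ (2 * η) * c ^ (1 / 2 - η) := by
      rw [← Real.rpow_add hcpos]; congr 1; ring
    rw [this]
    have := (Real.rpow_pos_of_pos hcpos (1 / 2 - η)).ne'
    field_simp
  rw [e1]
  rcases eq_or_ne t s with rfl | hts
  · rw [sub_self, abs_zero, Real.zero_rpow hα.ne', mul_zero]; positivity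
  have hd : 0 < |t - s| := abs_pos.2 (sub_ne_zero.2 hts)
  have hdT : |t - s| ≤ T := by
    rw [abs_le]; constructor <;> linarith [hs.1, hs.2, ht.1, ht.2]
  -- Lowering the order from `1/2 - η` to `1/2 - ε` costs `T ^ (ε - η)`; the total growth `T ^ (ε +
  -- η)` is below `T ^ (2ε)`.
  have e2 : |t - s| ^ (1 / 2 - η) ≤ T ^ (ε - η) * |t - s| ^ (1 / 2 - ε) := by
    rw [show 1 / 2 - η = (ε - η) + (1 / 2 - ε) by ring, Real.rpow_add hd]
    gcongr
  have e3 : c ^ (2 * η) ≤ 4 * T ^ (2 * η) := by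
    calc c ^ (2 * η) ≤ (2 * T) ^ (2 * η) := by gcongr
      _ = 2 ^ (2 * η) * T ^ (2 * η) := Real.mul_rpow (by norm_num) hT0.le
      _ ≤ 2 ^ (2 : ℝ) * T ^ (2 * η) := by
        gcongr
        · norm_num
        · linarith
      _ = 4 * T ^ (2 * η) := by norm_num
  calc K * S' * c ^ (2 * η) * |t - s| ^ (1 / 2 - η)
      ≤ K * S' * (4 * T ^ (2 * η)) * (T ^ (ε - η) * |t - s| ^ (1 / 2 - ε)) := by gcongr
    _ = K * S' * 4 * T ^ (ε + η) * |t - s| ^ (1 / 2 - ε) := by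
      rw [show ε + η = 2 * η + (ε - η) by ring, Real.rpow_add hT0]; ring
    _ ≤ K * S' * 4 * T ^ (2 * ε) * |t - s| ^ (1 / 2 - ε) := by
      gcongr
      linarith

theorem ProbabilityTheory.IsBrownianReal.ae_isHolderHalfPath {Ω : Type*} [MeasurableSpace Ω]
    {P : Measure Ω} {B : ℝ → Ω → ℝ} (hB : IsBrownianReal (fun (t : ℝ≥0) ω => B t ω) P) :
    ∀ᵐ ω ∂P, IsHolderHalfPath fun s => B s ω := by
  filter_upwards [hB.cont, hB.eval_zero_ae_eq_zero,
    ae_all_iff.2 hB.toIsPreBrownianReal.ae_exists_dyadic_increments_le] with ω h1 h2 h3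
  refine isHolderHalfPath_of_dyadic_increments (by simpa using h2) ?_ h3
  rw [continuousOn_iff_continuous_domRestrict]
  exact h1

/-! ### Derivatives of the kernels and their size -/

/-- The function `x ^ γ (log x) ^ n`, the `n`-th derivative of `x ^ γ` in `γ`. -/
noncomputable def powLog (n : ℕ) (γ x : ℝ) : ℝ := x ^ γ * Real.log x ^ n

/-- The derivative of `powLog n γ` at `x`. -/
noncomputable def powLogDeriv (n : ℕ) (γ x : ℝ) : ℝ :=
  γ * powLog n (γ - 1) x + n * powLog (n - 1) (γ - 1) x

theorem hasDerivAt_powLog_exponent (n : ℕ) (γ : ℝ) {x : ℝ} (hx : 0 < x) :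
    HasDerivAt (fun γ => powLog n γ x) (powLog (n + 1) γ x) γ := by
  refine (((Real.hasStrictDerivAt_const_rpow hx γ).hasDerivAt).mul_const
    (Real.log x ^ n)).congr_deriv ?_
  unfold powLog
  ring

theorem hasDerivAt_powLog (n : ℕ) (γ : ℝ) {x : ℝ} (hx : 0 < x) :
    HasDerivAt (powLog n γ) (powLogDeriv n γ x) x := by
  have h := (Real.hasDerivAt_rpow_const (p := γ) (Or.inl hx.ne')).mul
    ((Real.hasDerivAt_log hx.ne').pow n)
  refine h.congr_deriv ?_
  unfold powLogDeriv powLog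
  rw [Real.rpow_sub_one hx.ne']
  simp only [Pi.pow_apply]
  field_simp

theorem hasDerivAt_powLogDeriv (n : ℕ) (γ : ℝ) {x : ℝ} (hx : 0 < x) :
    HasDerivAt (powLogDeriv n γ)
      (γ * powLogDeriv n (γ - 1) x + n * powLogDeriv (n - 1) (γ - 1) x) x :=
  ((hasDerivAt_powLog n (γ - 1) hx).const_mul γ).add
    ((hasDerivAt_powLog (n - 1) (γ - 1) hx).const_mul (n : ℝ))

theorem fKerD_eq (n : ℕ) (H : ℝ) {t s : ℝ} (hs : s < 0) (ht : s < t) :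
    fKerD n H t s = powLog n (H - 1 / 2) (t - s) - powLog n (H - 1 / 2) (-s) := by
  unfold fKerD
  induction n generalizing H with
  | zero => simp [fKer, powLog]
  | succ n ih =>
    rw [iteratedDeriv_succ, funext ih]
    exact (((hasDerivAt_powLog_exponent n _ (sub_pos.2 ht)).comp_sub_const H (1 / 2)).sub
      ((hasDerivAt_powLog_exponent n _ (neg_pos.2 hs)).comp_sub_const H (1 / 2))).deriv

theorem gKerD_eq (n : ℕ) (H : ℝ) {t s : ℝ} (ht : s < t) :
    gKerD n H t s = powLog n (H - 1 / 2) (t - s) := by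
  unfold gKerD
  induction n generalizing H with
  | zero => simp [gKer, powLog]
  | succ n ih =>
    rw [iteratedDeriv_succ, funext ih]
    exact ((hasDerivAt_powLog_exponent n _ (sub_pos.2 ht)).comp_sub_const H (1 / 2)).deriv

theorem deriv_fKerD (n : ℕ) (H : ℝ) {t s : ℝ} (hs : s < 0) (ht : s < t) :
    deriv (fun r => fKerD n H t r) s
      = powLogDeriv n (H - 1 / 2) (-s) - powLogDeriv n (H - 1 / 2) (t - s) := by
  have h : (fun r => fKerD n H t r) =ᶠ[nhds s]
      fun r => powLog n (H - 1 / 2) (t - r) - powLog n (H - 1 / 2) (-r) := by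
    filter_upwards [Iio_mem_nhds hs, Iio_mem_nhds ht] with r h1 h2 using fKerD_eq n H h1 h2
  rw [h.deriv_eq]
  have h1 := (hasDerivAt_powLog n (H - 1 / 2) (sub_pos.2 ht)).comp s
    ((hasDerivAt_id s).const_sub t)
  have h2 := (hasDerivAt_powLog n (H - 1 / 2) (neg_pos.2 hs)).comp s (hasDerivAt_neg s)
  refine (h1.sub h2).deriv.trans ?_
  ring

theorem deriv_gKerD (n : ℕ) (H : ℝ) {t s : ℝ} (ht : s < t) :
    deriv (fun r => gKerD n H t r) s = -powLogDeriv n (H - 1 / 2) (t - s) := by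
  have h : (fun r => gKerD n H t r) =ᶠ[nhds s] fun r => powLog n (H - 1 / 2) (t - r) := by
    filter_upwards [Iio_mem_nhds ht] with r h2 using gKerD_eq n H h2
  rw [h.deriv_eq]
  have h1 := (hasDerivAt_powLog n (H - 1 / 2) (sub_pos.2 ht)).comp s
    ((hasDerivAt_id s).const_sub t)
  refine h1.deriv.trans ?_
  ring

@[fun_prop]
theorem measurable_powLogDeriv (n : ℕ) (γ : ℝ) : Measurable (powLogDeriv n γ) := by
  unfold powLogDeriv powLog
  fun_prop

theorem continuousAt_powLog (n : ℕ) (γ : ℝ) {x : ℝ} (hx : 0 < x) :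
    ContinuousAt (fun p : ℝ × ℝ => powLog n p.1 p.2) (γ, x) := by
  unfold powLog
  exact (continuousAt_snd.rpow continuousAt_fst (Or.inl hx.ne')).mul
    ((continuousAt_snd.log hx.ne').pow n)

theorem continuousAt_powLogDeriv (n : ℕ) (γ : ℝ) {x : ℝ} (hx : 0 < x) :
    ContinuousAt (fun p : ℝ × ℝ => powLogDeriv n p.1 p.2) (γ, x) := by
  unfold powLogDeriv
  have h (m : ℕ) : ContinuousAt (fun p : ℝ × ℝ => powLog m (p.1 - 1) p.2) (γ, x) :=
    ContinuousAt.comp (g := fun p : ℝ × ℝ => powLog m p.1 p.2)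
      (f := fun p : ℝ × ℝ => (p.1 - 1, p.2)) (continuousAt_powLog m (γ - 1) hx) (by fun_prop)
  exact (continuousAt_fst.mul (h n)).add (continuousAt_const.mul (h (n - 1)))

/-- From `y ^ n / n! ≤ exp y` with `y = δ |log x|`. The constant does not depend on `γ`, which makes
the later bounds uniform in `H`. -/
theorem abs_powLog_le (n : ℕ) {δ : ℝ} (hδ : 0 < δ) (γ : ℝ) {x : ℝ} (hx : 0 < x) :
    |powLog n γ x| ≤ n.factorial / δ ^ n * (x ^ (γ + δ) + x ^ (γ - δ)) := by
  have h1 : (δ * |Real.log x|) ^ n / n.factorial ≤ Real.exp (δ * |Real.log x|) :=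
    Real.pow_div_factorial_le_exp _ (by positivity) n
  have h2 : Real.exp (δ * |Real.log x|) ≤ x ^ δ + x ^ (-δ) := by
    rw [Real.rpow_def_of_pos hx, Real.rpow_def_of_pos hx]
    have e1 := Real.exp_pos (Real.log x * δ)
    have e2 := Real.exp_pos (Real.log x * -δ)
    rcases abs_cases (Real.log x) with ⟨h, _⟩ | ⟨h, _⟩ <;> rw [h]
    · rw [mul_comm δ]; linarith
    · rw [show δ * -Real.log x = Real.log x * -δ by ring]; linarith
  have h3 := h1.trans h2
  have hf : (0 : ℝ) < n.factorial := by exact_mod_cast n.factorial_pos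
  rw [mul_pow, div_le_iff₀ hf] at h3
  unfold powLog
  rw [abs_mul, abs_pow, abs_of_pos (Real.rpow_pos_of_pos hx γ), Real.rpow_add hx,
    sub_eq_add_neg, Real.rpow_add hx, ← mul_add]
  have hδn : 0 < δ ^ n := by positivity
  have h4 : |Real.log x| ^ n ≤ n.factorial / δ ^ n * (x ^ δ + x ^ (-δ)) := by
    rw [div_mul_eq_mul_div, le_div_iff₀ hδn]; linarith
  calc x ^ γ * |Real.log x| ^ n ≤ x ^ γ * (n.factorial / δ ^ n * (x ^ δ + x ^ (-δ))) := by gcongr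
    _ = _ := by ring

theorem exists_abs_powLogDeriv_le (n : ℕ) {δ : ℝ} (hδ : 0 < δ) :
    ∃ C : ℝ, 0 ≤ C ∧ ∀ γ : ℝ, |γ| ≤ 2 → ∀ x : ℝ, 0 < x →
      |powLogDeriv n γ x| ≤ C * (x ^ (γ - 1 + δ) + x ^ (γ - 1 - δ)) := by
  refine ⟨2 * (n.factorial / δ ^ n) + n * ((n - 1).factorial / δ ^ (n - 1)), by positivity,
    fun γ hγ x hx => ?_⟩
  have h1 := abs_powLog_le n hδ (γ - 1) hx
  have h2 := abs_powLog_le (n - 1) hδ (γ - 1) hx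
  unfold powLogDeriv
  calc _ ≤ |γ| * |powLog n (γ - 1) x| + n * |powLog (n - 1) (γ - 1) x| := by
        refine (abs_add_le _ _).trans ?_
        rw [abs_mul, abs_mul, Nat.abs_cast]
    _ ≤ 2 * (n.factorial / δ ^ n * (x ^ (γ - 1 + δ) + x ^ (γ - 1 - δ)))
          + n * ((n - 1).factorial / δ ^ (n - 1) * (x ^ (γ - 1 + δ) + x ^ (γ - 1 - δ))) := by
        gcongr
    _ = _ := by ring

/-- Mean value inequality: one more derivative lowers the exponent by one. For `γ, δ ≤ 1` the
exponents `γ - 2 ± δ` are nonpositive, so the bound on `[x, y]` is attained at `x`. -/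
theorem exists_abs_powLogDeriv_sub_le (n : ℕ) {δ : ℝ} (hδ : 0 < δ) (hδ1 : δ ≤ 1) :
    ∃ C : ℝ, 0 ≤ C ∧ ∀ γ : ℝ, |γ| ≤ 1 → ∀ x y : ℝ, 0 < x → x ≤ y →
      |powLogDeriv n γ x - powLogDeriv n γ y|
        ≤ C * (x ^ (γ - 2 + δ) + x ^ (γ - 2 - δ)) * (y - x) := by
  obtain ⟨C₁, hC₁, h₁⟩ := exists_abs_powLogDeriv_le n hδ
  obtain ⟨C₂, hC₂, h₂⟩ := exists_abs_powLogDeriv_le (n - 1) hδ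
  refine ⟨C₁ + n * C₂, by positivity, fun γ hγ x y hx hxy => ?_⟩
  have hγ2 : |γ - 1| ≤ 2 := by
    rw [abs_le] at hγ ⊢; constructor <;> linarith
  have hγ1 := (abs_le.1 hγ).2
  have key := Convex.norm_image_sub_le_of_norm_hasDerivWithin_le (s := Icc x y)
    (f := powLogDeriv n γ) (C := (C₁ + n * C₂) * (x ^ (γ - 2 + δ) + x ^ (γ - 2 - δ)))
    (fun z hz => (hasDerivAt_powLogDeriv n γ (hx.trans_le hz.1)).hasDerivWithinAt) ?_
    (convex_Icc x y) (left_mem_Icc.2 hxy) (right_mem_Icc.2 hxy)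
  · rw [abs_sub_comm]
    rwa [Real.norm_eq_abs, Real.norm_eq_abs, abs_of_nonneg (sub_nonneg.2 hxy)] at key
  · intro z hz
    have hz0 := hx.trans_le hz.1
    have b1 := h₁ (γ - 1) hγ2 z hz0
    have b2 := h₂ (γ - 1) hγ2 z hz0
    have m1 : z ^ (γ - 2 + δ) ≤ x ^ (γ - 2 + δ) :=
      Real.rpow_le_rpow_of_nonpos hx hz.1 (by linarith)
    have m2 : z ^ (γ - 2 - δ) ≤ x ^ (γ - 2 - δ) :=
      Real.rpow_le_rpow_of_nonpos hx hz.1 (by linarith)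
    rw [show γ - 1 - 1 = γ - 2 by ring] at b1 b2
    calc _ ≤ |γ| * |powLogDeriv n (γ - 1) z| + n * |powLogDeriv (n - 1) (γ - 1) z| := by
          refine (norm_add_le _ _).trans ?_
          rw [norm_mul, norm_mul, Real.norm_natCast]
          rfl
      _ ≤ 1 * (C₁ * (x ^ (γ - 2 + δ) + x ^ (γ - 2 - δ)))
          + n * (C₂ * (x ^ (γ - 2 + δ) + x ^ (γ - 2 - δ))) := by
          have b1' := b1.trans (mul_le_mul_of_nonneg_left (add_le_add m1 m2) hC₁)
          have b2' := b2.trans (mul_le_mul_of_nonneg_left (add_le_add m1 m2) hC₂)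
          gcongr
      _ = _ := by ring

/-! ### Integrable majorants, uniform in `H` and `t` -/

theorem integrableOn_Ioi_ite_rpow {p q : ℝ} (hp : -1 < p) (hq : q < -1) :
    IntegrableOn (fun x : ℝ => if x ≤ 1 then x ^ p else x ^ q) (Ioi 0) := by
  rw [← Ioc_union_Ioi_eq_Ioi (zero_le_one (α := ℝ))]
  refine IntegrableOn.union ?_ ?_
  · have h := (intervalIntegral.intervalIntegrable_rpow' (a := 0) (b := 1) hp).1
    exact h.congr_fun (fun x hx => (if_pos hx.2).symm) measurableSet_Ioc
  · exact (integrableOn_Ioi_rpow_of_lt hq zero_lt_one).congr_fun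
      (fun x hx => (if_neg (not_le.2 hx)).symm) measurableSet_Ioi

theorem IsHolderHalfPath.exists_abs_le {w : ℝ → ℝ} (hw : IsHolderHalfPath w) {ε : ℝ} (hε : 0 < ε)
    (hε2 : ε < 1 / 2) : ∃ C : ℝ, 0 ≤ C ∧ (∀ x : ℝ, 0 ≤ x → x ≤ 1 → |w x| ≤ C * x ^ (1 / 2 - ε)) ∧
      ∀ x : ℝ, 1 ≤ x → |w x| ≤ C * x ^ (1 / 2 + ε) := by
  obtain ⟨C, hC, h⟩ := hw.holder ε hε hε2
  refine ⟨C, hC, fun x hx hx1 => ?_, fun x hx => ?_⟩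
  · have := h 1 le_rfl 0 ⟨le_rfl, zero_le_one⟩ x ⟨hx, hx1⟩
    simpa [hw.zero, abs_of_nonneg hx] using this
  · have h0 : 0 < x := by linarith
    have := h x hx 0 ⟨le_rfl, h0.le⟩ x ⟨h0.le, le_rfl⟩
    rw [hw.zero, sub_zero, sub_zero, abs_of_pos h0, mul_assoc, ← Real.rpow_add h0] at this
    convert this using 3
    ring

/-- Here `x = -s`. For `x ≤ 1` the two kernel terms are bounded separately; for `x > 1` their
difference over a step of length `t ≤ T` gains the power of `x` needed at infinity. -/
theorem IsHolderHalfPath.exists_integrableOn_bound_neg {w : ℝ → ℝ} (hw : IsHolderHalfPath w)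
    (n : ℕ) {a c T : ℝ} (ha : 0 < a) (hac : a ≤ c) (hc : c < 1) (hT : 0 ≤ T) :
    ∃ G : ℝ → ℝ, IntegrableOn G (Ioi 0) ∧ ∀ H ∈ Icc a c, ∀ t ∈ Icc 0 T, ∀ x ∈ Ioi (0 : ℝ),
      ‖(powLogDeriv n (H - 1 / 2) x - powLogDeriv n (H - 1 / 2) (t + x)) * w x‖ ≤ G x := by
  -- Exactly what makes `a - 1 - 2 * η > -1` and `c - 2 + 2 * η < -1`.
  obtain ⟨η, hη, hηa, hηc⟩ : ∃ η : ℝ, 0 < η ∧ 2 * η < a ∧ 2 * η < 1 - c := by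
    have : 0 < min a (1 - c) := lt_min ha (by linarith)
    refine ⟨min a (1 - c) / 4, by positivity, ?_, ?_⟩
    · linarith [min_le_left a (1 - c)]
    · linarith [min_le_right a (1 - c)]
  obtain ⟨C₀, hC₀, hw0, hw1⟩ := hw.exists_abs_le hη (by linarith)
  obtain ⟨C₁, hC₁, h₁⟩ := exists_abs_powLogDeriv_le n hη
  obtain ⟨C₂, hC₂, h₂⟩ := exists_abs_powLogDeriv_sub_le n hη (by linarith)
  set D := C₁ * 4 * C₀ + C₂ * 2 * T * C₀ with hD
  refine ⟨fun x => D * if x ≤ 1 then x ^ (a - 1 - 2 * η) else x ^ (c - 2 + 2 * η),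
    (integrableOn_Ioi_ite_rpow (by linarith) (by linarith)).const_mul D,
    fun H hH t ht x hx => ?_⟩
  have hx : 0 < x := hx
  have hβ1 : |H - 1 / 2| ≤ 1 := by rw [abs_le]; constructor <;> linarith [hH.1, hH.2]
  have hβ2 : |H - 1 / 2| ≤ 2 := by linarith
  rw [norm_mul, Real.norm_eq_abs, Real.norm_eq_abs]
  rcases le_or_gt x 1 with hx1 | hx1
  · simp only [if_pos hx1]
    have hxt : x ≤ t + x := by linarith [ht.1]
    have e1 : x ^ (H - 1 / 2 - 1 + η) ≤ x ^ (a - 3 / 2 - η) :=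
      Real.rpow_le_rpow_of_exponent_ge hx hx1 (by linarith [hH.1])
    have e2 : x ^ (H - 1 / 2 - 1 - η) ≤ x ^ (a - 3 / 2 - η) :=
      Real.rpow_le_rpow_of_exponent_ge hx hx1 (by linarith [hH.1])
    have e3 : (t + x) ^ (H - 1 / 2 - 1 + η) ≤ x ^ (H - 1 / 2 - 1 + η) :=
      Real.rpow_le_rpow_of_nonpos hx hxt (by linarith [hH.2])
    have e4 : (t + x) ^ (H - 1 / 2 - 1 - η) ≤ x ^ (H - 1 / 2 - 1 - η) :=
      Real.rpow_le_rpow_of_nonpos hx hxt (by linarith [hH.2])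
    have b1 := (h₁ _ hβ2 x hx).trans (mul_le_mul_of_nonneg_left (add_le_add e1 e2) hC₁)
    have b2 := (h₁ _ hβ2 (t + x) (by linarith)).trans
      (mul_le_mul_of_nonneg_left (add_le_add (e3.trans e1) (e4.trans e2)) hC₁)
    have e5 : x ^ (a - 1 - 2 * η) = x ^ (a - 3 / 2 - η) * x ^ (1 / 2 - η) := by
      rw [← Real.rpow_add hx]; congr 1; ring
    have hTD : 0 ≤ C₂ * 2 * T * C₀ := by positivity
    calc _ ≤ (C₁ * (x ^ (a - 3 / 2 - η) + x ^ (a - 3 / 2 - η))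
            + C₁ * (x ^ (a - 3 / 2 - η) + x ^ (a - 3 / 2 - η))) * (C₀ * x ^ (1 / 2 - η)) :=
          mul_le_mul ((abs_sub _ _).trans (add_le_add b1 b2)) (hw0 x hx.le hx1) (abs_nonneg _)
            (by positivity)
      _ = C₁ * 4 * C₀ * x ^ (a - 1 - 2 * η) := by rw [e5]; ring
      _ ≤ _ := by gcongr; linarith
  · simp only [if_neg (not_le.2 hx1)]
    have e1 : x ^ (H - 1 / 2 - 2 + η) ≤ x ^ (c - 5 / 2 + η) :=
      Real.rpow_le_rpow_of_exponent_le hx1.le (by linarith [hH.2])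
    have e2 : x ^ (H - 1 / 2 - 2 - η) ≤ x ^ (c - 5 / 2 + η) :=
      Real.rpow_le_rpow_of_exponent_le hx1.le (by linarith [hH.2])
    have b := h₂ _ hβ1 x (t + x) hx (by linarith [ht.1])
    rw [add_sub_cancel_right] at b
    have b' := b.trans (mul_le_mul (mul_le_mul_of_nonneg_left (add_le_add e1 e2) hC₂) ht.2 ht.1
      (by positivity))
    have e5 : x ^ (c - 2 + 2 * η) = x ^ (c - 5 / 2 + η) * x ^ (1 / 2 + η) := by
      rw [← Real.rpow_add hx]; congr 1; ring
    have hTD : 0 ≤ C₁ * 4 * C₀ := by positivity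
    calc _ ≤ (C₂ * (x ^ (c - 5 / 2 + η) + x ^ (c - 5 / 2 + η)) * T) * (C₀ * x ^ (1 / 2 + η)) :=
          mul_le_mul b' (hw1 x hx1.le) (abs_nonneg _) (by positivity)
      _ = C₂ * 2 * T * C₀ * x ^ (c - 2 + 2 * η) := by rw [e5]; ring
      _ ≤ _ := by gcongr; linarith

/-- Here `u = t - s`: the Hölder bound for `w t - w (t - u)` compensates the singularity of the
kernel at `u = 0`. -/
theorem IsHolderHalfPath.exists_integrableOn_bound_pos {w : ℝ → ℝ} (hw : IsHolderHalfPath w)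
    (n : ℕ) {a c T : ℝ} (ha : 0 < a) (hc : c < 1) (hT : 1 ≤ T) :
    ∃ G : ℝ → ℝ, IntegrableOn G (Ioo 0 T) ∧ (∀ u ∈ Ioo 0 T, 0 ≤ G u) ∧
      ∀ H ∈ Icc a c, ∀ t ∈ Icc 0 T, ∀ u ∈ Ioo 0 t,
      ‖powLogDeriv n (H - 1 / 2) u * (w t - w (t - u))‖ ≤ G u := by
  obtain ⟨η, hη, hηa, hη4⟩ : ∃ η : ℝ, 0 < η ∧ 2 * η < a ∧ η < 1 / 4 := by
    refine ⟨min a (1 / 2) / 4, by positivity, ?_, ?_⟩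
    · linarith [min_le_left a (1 / 2)]
    · linarith [min_le_right a (1 / 2)]
  obtain ⟨C₀, hC₀, hw0⟩ := hw.holder η hη (by linarith)
  obtain ⟨C₁, hC₁, h₁⟩ := exists_abs_powLogDeriv_le n hη
  have hT0 : 0 < T := by linarith
  set D := C₁ * 2 * T ^ (2 : ℝ) * (C₀ * T ^ (2 * η)) with hD
  have hD0 : 0 ≤ D := by positivity
  refine ⟨fun u => D * u ^ (a - 1 - 2 * η), ?_, fun u hu => ?_, fun H hH t ht u hu => ?_⟩
  · have h := (intervalIntegral.intervalIntegrable_rpow' (a := 0) (b := T)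
      (by linarith : -1 < a - 1 - 2 * η)).1
    exact (h.mono_set Ioo_subset_Ioc_self).const_mul D
  · have := Real.rpow_nonneg hu.1.le (a - 1 - 2 * η)
    positivity
  have hu0 : 0 < u := hu.1
  have huT : u ≤ T := hu.2.le.trans ht.2
  have hβ2 : |H - 1 / 2| ≤ 2 := by rw [abs_le]; constructor <;> linarith [hH.1, hH.2]
  -- Since `u` may exceed `1`, powers of `u` are not monotone in the exponent; an excess of at most
  -- `2` costs at most `T ^ 2`.
  have cmp : ∀ x : ℝ, a - 3 / 2 - η ≤ x → x ≤ a - 3 / 2 - η + 2 →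
      u ^ x ≤ T ^ (2 : ℝ) * u ^ (a - 3 / 2 - η) := by
    intro x hx1 hx2
    rw [show x = (x - (a - 3 / 2 - η)) + (a - 3 / 2 - η) by ring, Real.rpow_add hu0]
    gcongr
    calc u ^ (x - (a - 3 / 2 - η)) ≤ T ^ (x - (a - 3 / 2 - η)) :=
          Real.rpow_le_rpow hu0.le huT (by linarith)
      _ ≤ T ^ (2 : ℝ) := Real.rpow_le_rpow_of_exponent_le hT (by linarith)
  have e1 := cmp (H - 1 / 2 - 1 + η) (by linarith [hH.1]) (by linarith [hH.2])
  have e2 := cmp (H - 1 / 2 - 1 - η) (by linarith [hH.1]) (by linarith [hH.2])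
  have b1 := (h₁ _ hβ2 u hu0).trans (mul_le_mul_of_nonneg_left (add_le_add e1 e2) hC₁)
  have b2 := hw0 T hT (t - u) ⟨by linarith [hu.2], by linarith [ht.2]⟩ t ht
  rw [sub_sub_cancel, abs_of_pos hu0] at b2
  have e5 : u ^ (a - 1 - 2 * η) = u ^ (a - 3 / 2 - η) * u ^ (1 / 2 - η) := by
    rw [← Real.rpow_add hu0]; congr 1; ring
  rw [norm_mul, Real.norm_eq_abs, Real.norm_eq_abs]
  calc _ ≤ (C₁ * (T ^ (2 : ℝ) * u ^ (a - 3 / 2 - η) + T ^ (2 : ℝ) * u ^ (a - 3 / 2 - η)))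
        * (C₀ * T ^ (2 * η) * u ^ (1 / 2 - η)) :=
        mul_le_mul b1 b2 (abs_nonneg _) (by positivity)
    _ = D * u ^ (a - 1 - 2 * η) := by rw [e5, hD]; ring

/-! ### Absolute convergence and joint continuity -/

theorem integrableOn_pwzNegIntegrand {b : ℝ → ℝ} (hb : Continuous b)
    (hn : IsHolderHalfPath fun s => b (-s)) (n : ℕ) {H t : ℝ} (hH : H ∈ Ioo (0 : ℝ) 1)
    (ht : 0 ≤ t) : IntegrableOn (pwzNegIntegrand b n H t) (Iio 0) := by
  obtain ⟨G, hG, hbd⟩ := hn.exists_integrableOn_bound_neg n hH.1 le_rfl hH.2 ht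
  have h : IntegrableOn (fun x => pwzNegIntegrand b n H t (-x)) (Ioi 0) := by
    have h0 : IntegrableOn (fun x => (powLogDeriv n (H - 1 / 2) x
        - powLogDeriv n (H - 1 / 2) (t + x)) * b (-x)) (Ioi 0) := by
      refine Integrable.mono' hG (Measurable.aestronglyMeasurable (by fun_prop)) ?_
      filter_upwards [ae_restrict_mem measurableSet_Ioi] with x hx
      exact hbd H ⟨le_rfl, le_rfl⟩ t ⟨ht, le_rfl⟩ x hx
    refine h0.congr_fun (fun x (hx : 0 < x) => ?_) measurableSet_Ioi
    simp only [pwzNegIntegrand]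
    rw [deriv_fKerD n H (by linarith) (by linarith), neg_neg, sub_neg_eq_add]
  have h' : IntegrableOn (fun x => pwzNegIntegrand b n H t (-x)) (Ioi (-0)) := by
    rwa [neg_zero]
  have h2 := h'.comp_neg_Iio
  refine h2.congr_fun (fun x _ => ?_) measurableSet_Iio
  exact congrArg (pwzNegIntegrand b n H t) (neg_neg x)

theorem pwzNegIntegral_eq (b : ℝ → ℝ) (n : ℕ) (H : ℝ) {t : ℝ} (ht : 0 ≤ t) :
    ∫ s in Iio (0 : ℝ), pwzNegIntegrand b n H t s
      = ∫ x in Ioi (0 : ℝ),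
        (powLogDeriv n (H - 1 / 2) x - powLogDeriv n (H - 1 / 2) (t + x)) * b (-x) := by
  rw [← integral_Iic_eq_integral_Iio, ← neg_zero, ← integral_comp_neg_Ioi, neg_zero]
  refine setIntegral_congr_fun measurableSet_Ioi fun x (hx : 0 < x) => ?_
  simp only [pwzNegIntegrand]
  rw [deriv_fKerD n H (by linarith) (by linarith), neg_neg, sub_neg_eq_add]

theorem indicator_pwzPosIntegrand (b : ℝ → ℝ) (n : ℕ) (H t u : ℝ) :
    (Ioo 0 t).indicator (pwzPosIntegrand b n H t) (t - u)
      = (Ioo 0 t).indicator (fun u => -(powLogDeriv n (H - 1 / 2) u * (b t - b (t - u)))) u := by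
  by_cases hu : u ∈ Ioo 0 t
  · have ht : t - u ∈ Ioo 0 t := ⟨by linarith [hu.2], by linarith [hu.1]⟩
    rw [indicator_of_mem hu, indicator_of_mem ht,
      pwzPosIntegrand, deriv_gKerD n H (by linarith [hu.1]), sub_sub_cancel, neg_mul]
  · rw [indicator_of_notMem hu, indicator_of_notMem]
    exact fun h => hu ⟨by linarith [h.2], by linarith [h.1]⟩

/-- The substitution `u = t - s` fixes the singularity at `u = 0`, and the indicator moves the
variable endpoint into the integrand, as dominated convergence requires. -/
theorem pwzPosIntegral_eq (b : ℝ → ℝ) (n : ℕ) (H : ℝ) {t T : ℝ} (ht : t ≤ T) :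
    ∫ s in Ioo (0 : ℝ) t, pwzPosIntegrand b n H t s
      = ∫ u in Ioo (0 : ℝ) T, (Ioo 0 t).indicator
        (fun u => -(powLogDeriv n (H - 1 / 2) u * (b t - b (t - u)))) u := by
  rw [setIntegral_indicator measurableSet_Ioo, inter_eq_right.2 (Ioo_subset_Ioo_right ht),
    ← integral_indicator measurableSet_Ioo, ← integral_indicator measurableSet_Ioo,
    ← integral_sub_left_eq_self _ volume t]
  exact integral_congr_ae (Filter.Eventually.of_forall fun u => indicator_pwzPosIntegrand b n H t u)

theorem integrableOn_pwzPosIntegrand {b : ℝ → ℝ} (hb : Continuous b) (hp : IsHolderHalfPath b)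
    (n : ℕ) {H t : ℝ} (hH : H ∈ Ioo (0 : ℝ) 1) (ht : 0 ≤ t) :
    IntegrableOn (pwzPosIntegrand b n H t) (Ioo 0 t) := by
  obtain ⟨G, hG, -, hbd⟩ :=
    hp.exists_integrableOn_bound_pos n hH.1 hH.2 (by linarith : 1 ≤ t + 1)
  have h0 : IntegrableOn (fun u => -(powLogDeriv n (H - 1 / 2) u * (b t - b (t - u)))) (Ioo 0 t) := by
    refine Integrable.mono' (hG.mono_set (Ioo_subset_Ioo_right (by linarith)))
      (Measurable.aestronglyMeasurable (by fun_prop)) ?_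
    filter_upwards [ae_restrict_mem measurableSet_Ioo] with u hu
    rw [norm_neg]
    exact hbd H ⟨le_rfl, le_rfl⟩ t ⟨ht, by linarith⟩ u hu
  rw [← integrable_indicator_iff measurableSet_Ioo] at h0 ⊢
  have := (h0.congr (Filter.Eventually.of_forall fun u =>
    (indicator_pwzPosIntegrand b n H t u).symm)).comp_sub_left t
  simpa using this

theorem continuousWithinAt_pwzNegIntegral {b : ℝ → ℝ} (hb : Continuous b)
    (hn : IsHolderHalfPath fun s => b (-s)) (n : ℕ) {p₀ : ℝ × ℝ}
    (hp₀ : p₀ ∈ Ioo (0 : ℝ) 1 ×ˢ Ici (0 : ℝ)) :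
    ContinuousWithinAt (fun p : ℝ × ℝ => ∫ s in Iio (0 : ℝ), pwzNegIntegrand b n p.1 p.2 s)
      (Ioo (0 : ℝ) 1 ×ˢ Ici (0 : ℝ)) p₀ := by
  obtain ⟨H₀, t₀⟩ := p₀
  obtain ⟨⟨hH0, hH1⟩, ht0⟩ := hp₀
  simp only [mem_Ici] at hH0 hH1 ht0
  obtain ⟨G, hG, hbd⟩ := hn.exists_integrableOn_bound_neg n (a := H₀ / 2) (c := (H₀ + 1) / 2)
    (T := t₀ + 1) (by linarith) (by linarith) (by linarith) (by linarith)
  have hnhds : ∀ᶠ p : ℝ × ℝ in nhdsWithin (H₀, t₀) (Ioo (0 : ℝ) 1 ×ˢ Ici (0 : ℝ)),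
      p.1 ∈ Icc (H₀ / 2) ((H₀ + 1) / 2) ∧ p.2 ∈ Icc 0 (t₀ + 1) := by
    have h1 : Ioo (H₀ / 2) ((H₀ + 1) / 2) ×ˢ Iio (t₀ + 1) ∈ nhds (H₀, t₀) :=
      prod_mem_nhds (Ioo_mem_nhds (by linarith) (by linarith)) (Iio_mem_nhds (by linarith))
    filter_upwards [mem_nhdsWithin_of_mem_nhds h1, self_mem_nhdsWithin] with p hp hp'
    exact ⟨⟨hp.1.1.le, hp.1.2.le⟩, hp'.2, (mem_Iio.1 hp.2).le⟩
  have key : ContinuousWithinAt (fun p : ℝ × ℝ => ∫ x in Ioi (0 : ℝ),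
      (powLogDeriv n (p.1 - 1 / 2) x - powLogDeriv n (p.1 - 1 / 2) (p.2 + x)) * b (-x))
      (Ioo (0 : ℝ) 1 ×ˢ Ici (0 : ℝ)) (H₀, t₀) := by
    refine continuousWithinAt_of_dominated (bound := G) ?_ ?_ hG ?_
    · exact Filter.Eventually.of_forall fun p => Measurable.aestronglyMeasurable (by fun_prop)
    · filter_upwards [hnhds] with p hp
      filter_upwards [ae_restrict_mem measurableSet_Ioi] with x hx using hbd _ hp.1 _ hp.2 x hx
    · filter_upwards [ae_restrict_mem measurableSet_Ioi] with x hx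
      have hx : 0 < x := hx
      refine ContinuousAt.continuousWithinAt (ContinuousAt.mul (ContinuousAt.sub ?_ ?_)
        continuousAt_const)
      · exact ContinuousAt.comp (g := fun p : ℝ × ℝ => powLogDeriv n p.1 p.2)
          (f := fun p : ℝ × ℝ => (p.1 - 1 / 2, x)) (continuousAt_powLogDeriv n _ hx) (by fun_prop)
      · exact ContinuousAt.comp (g := fun p : ℝ × ℝ => powLogDeriv n p.1 p.2)
          (f := fun p : ℝ × ℝ => (p.1 - 1 / 2, p.2 + x))
          (continuousAt_powLogDeriv n _ (by simp only; linarith)) (by fun_prop)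
  exact key.congr (fun p hp => pwzNegIntegral_eq b n p.1 hp.2) (pwzNegIntegral_eq b n H₀ ht0)

theorem continuousWithinAt_pwzPosIntegral {b : ℝ → ℝ} (hb : Continuous b)
    (hp : IsHolderHalfPath b) (n : ℕ) {p₀ : ℝ × ℝ}
    (hp₀ : p₀ ∈ Ioo (0 : ℝ) 1 ×ˢ Ici (0 : ℝ)) :
    ContinuousWithinAt (fun p : ℝ × ℝ => ∫ s in Ioo (0 : ℝ) p.2, pwzPosIntegrand b n p.1 p.2 s)
      (Ioo (0 : ℝ) 1 ×ˢ Ici (0 : ℝ)) p₀ := by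
  obtain ⟨H₀, t₀⟩ := p₀
  obtain ⟨⟨hH0, hH1⟩, ht0⟩ := hp₀
  simp only [mem_Ici] at hH0 hH1 ht0
  obtain ⟨G, hG, hG0, hbd⟩ := hp.exists_integrableOn_bound_pos n (a := H₀ / 2) (c := (H₀ + 1) / 2)
    (T := t₀ + 1) (by linarith) (by linarith) (by linarith)
  have hnhds : ∀ᶠ p : ℝ × ℝ in nhdsWithin (H₀, t₀) (Ioo (0 : ℝ) 1 ×ˢ Ici (0 : ℝ)),
      p.1 ∈ Icc (H₀ / 2) ((H₀ + 1) / 2) ∧ p.2 ∈ Icc 0 (t₀ + 1) := by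
    have h1 : Ioo (H₀ / 2) ((H₀ + 1) / 2) ×ˢ Iio (t₀ + 1) ∈ nhds (H₀, t₀) :=
      prod_mem_nhds (Ioo_mem_nhds (by linarith) (by linarith)) (Iio_mem_nhds (by linarith))
    filter_upwards [mem_nhdsWithin_of_mem_nhds h1, self_mem_nhdsWithin] with p hp hp'
    exact ⟨⟨hp.1.1.le, hp.1.2.le⟩, hp'.2, (mem_Iio.1 hp.2).le⟩
  have key : ContinuousWithinAt (fun p : ℝ × ℝ => ∫ u in Ioo (0 : ℝ) (t₀ + 1),
      (Ioo 0 p.2).indicator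
        (fun u => -(powLogDeriv n (p.1 - 1 / 2) u * (b p.2 - b (p.2 - u)))) u)
      (Ioo (0 : ℝ) 1 ×ˢ Ici (0 : ℝ)) (H₀, t₀) := by
    refine continuousWithinAt_of_dominated (bound := G) ?_ ?_ hG ?_
    · exact Filter.Eventually.of_forall fun p =>
        (Measurable.indicator (by fun_prop) measurableSet_Ioo).aestronglyMeasurable
    · filter_upwards [hnhds] with p hp
      filter_upwards [ae_restrict_mem measurableSet_Ioo] with u hu
      by_cases hut : u ∈ Ioo 0 p.2
      · rw [indicator_of_mem hut, norm_neg]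
        exact hbd _ hp.1 _ hp.2 u hut
      · rw [indicator_of_notMem hut, norm_zero]
        exact hG0 u hu
    -- The indicator is locally constant in `t` near `t₀` unless `u = t₀`, a null set.
    · filter_upwards [ae_restrict_mem measurableSet_Ioo,
        ae_restrict_of_ae (Measure.ae_ne volume t₀)] with u hu hut
      refine ContinuousAt.continuousWithinAt ?_
      rcases lt_or_gt_of_ne hut with h | h
      · have hc : ContinuousAt (fun p : ℝ × ℝ =>
            -(powLogDeriv n (p.1 - 1 / 2) u * (b p.2 - b (p.2 - u)))) (H₀, t₀) := by
          refine (ContinuousAt.mul ?_ (by fun_prop)).neg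
          exact ContinuousAt.comp (g := fun p : ℝ × ℝ => powLogDeriv n p.1 p.2)
            (f := fun p : ℝ × ℝ => (p.1 - 1 / 2, u)) (continuousAt_powLogDeriv n _ hu.1)
            (by fun_prop)
        refine hc.congr ?_
        filter_upwards [(isOpen_Ioi.preimage continuous_snd).mem_nhds (x := (H₀, t₀)) h] with p hp
        have hup : u ∈ Ioo 0 p.2 := ⟨hu.1, hp⟩
        rw [indicator_of_mem hup]
      · refine (continuousAt_const (y := (0 : ℝ))).congr (f := fun _ : ℝ × ℝ => (0 : ℝ)) ?_
        filter_upwards [(isOpen_Iio.preimage continuous_snd).mem_nhds (x := (H₀, t₀)) h] with p hp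
        have hup : u ∉ Ioo 0 p.2 := fun h' => lt_asymm h'.2 hp
        rw [indicator_of_notMem hup]
  refine key.congr_of_eventuallyEq ?_ (pwzPosIntegral_eq b n H₀ (by linarith))
  filter_upwards [hnhds] with p hp using pwzPosIntegral_eq b n p.1 hp.2.2

theorem continuousWithinAt_gKerD_mul {b : ℝ → ℝ} (hb : Continuous b) (hp : IsHolderHalfPath b)
    (n : ℕ) {p₀ : ℝ × ℝ} (hp₀ : p₀ ∈ Ioo (0 : ℝ) 1 ×ˢ Ici (0 : ℝ)) :
    ContinuousWithinAt (fun p : ℝ × ℝ => gKerD n p.1 p.2 0 * b p.2)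
      (Ioo (0 : ℝ) 1 ×ˢ Ici (0 : ℝ)) p₀ := by
  obtain ⟨H₀, t₀⟩ := p₀
  obtain ⟨⟨hH0, hH1⟩, ht0⟩ := hp₀
  simp only [mem_Ici] at hH0 hH1 ht0
  rcases ht0.lt_or_eq with ht | rfl
  · refine ContinuousAt.continuousWithinAt ?_
    have hc : ContinuousAt (fun p : ℝ × ℝ => powLog n (p.1 - 1 / 2) p.2 * b p.2) (H₀, t₀) := by
      refine ContinuousAt.mul ?_ (by fun_prop)
      exact ContinuousAt.comp (g := fun p : ℝ × ℝ => powLog n p.1 p.2)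
        (f := fun p : ℝ × ℝ => (p.1 - 1 / 2, p.2)) (continuousAt_powLog n _ ht) (by fun_prop)
    refine hc.congr ?_
    filter_upwards [(isOpen_Ioi.preimage continuous_snd).mem_nhds (x := (H₀, t₀)) ht] with p hp
    rw [gKerD_eq n p.1 hp, sub_zero]
  -- Near `H₀`, `H > H₀ / 2 = 4 * η`, so `H - 1/2 ± η ≥ 3 * η - 1/2`; multiplying by the path's `t ^
  -- (1/2 - η)` leaves `t ^ (2 * η) → 0`.
  · set η := H₀ / 8 with hη
    have hη0 : 0 < η := by positivity
    obtain ⟨C, hC, hw, -⟩ := hp.exists_abs_le hη0 (by linarith)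
    set D := n.factorial / η ^ n * 2 * C with hD
    have hlim : Filter.Tendsto (fun p : ℝ × ℝ => D * p.2 ^ (2 * η))
        (nhdsWithin (H₀, 0) (Ioo (0 : ℝ) 1 ×ˢ Ici (0 : ℝ))) (nhds 0) := by
      have : ContinuousAt (fun p : ℝ × ℝ => D * p.2 ^ (2 * η)) (H₀, 0) :=
        continuousAt_const.mul (continuousAt_snd.rpow_const (Or.inr (by positivity)))
      have h2 := this.continuousWithinAt.tendsto (s := Ioo (0 : ℝ) 1 ×ˢ Ici (0 : ℝ))
      simpa [Real.zero_rpow (by positivity : 2 * η ≠ 0)] using h2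
    unfold ContinuousWithinAt
    simp only [hp.zero, mul_zero]
    refine squeeze_zero_norm' ?_ hlim
    have h1 : Ioi (H₀ / 2) ×ˢ Iio 1 ∈ nhds (H₀, (0 : ℝ)) :=
      prod_mem_nhds (Ioi_mem_nhds (by linarith)) (Iio_mem_nhds (by linarith))
    filter_upwards [mem_nhdsWithin_of_mem_nhds h1, self_mem_nhdsWithin] with p hp1 hp2
    obtain ⟨H, t⟩ := p
    obtain ⟨hHH, ht1⟩ := hp1
    have ht0 : 0 ≤ t := hp2.2
    simp only [mem_Ioi, mem_Iio] at hHH ht1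
    simp only
    rcases ht0.lt_or_eq with ht | rfl
    · rw [gKerD_eq n H ht, sub_zero, norm_mul, Real.norm_eq_abs, Real.norm_eq_abs]
      have e1 : t ^ (H - 1 / 2 + η) ≤ t ^ (3 * η - 1 / 2) :=
        Real.rpow_le_rpow_of_exponent_ge ht ht1.le (by linarith)
      have e2 : t ^ (H - 1 / 2 - η) ≤ t ^ (3 * η - 1 / 2) :=
        Real.rpow_le_rpow_of_exponent_ge ht ht1.le (by linarith)
      have e3 : t ^ (2 * η) = t ^ (3 * η - 1 / 2) * t ^ (1 / 2 - η) := by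
        rw [← Real.rpow_add ht]; congr 1; ring
      calc _ ≤ (n.factorial / η ^ n * (t ^ (3 * η - 1 / 2) + t ^ (3 * η - 1 / 2)))
            * (C * t ^ (1 / 2 - η)) :=
            mul_le_mul ((abs_powLog_le n hη0 _ ht).trans
              (mul_le_mul_of_nonneg_left (add_le_add e1 e2) (by positivity)))
              (hw t ht.le ht1.le) (abs_nonneg _) (by positivity)
        _ = D * t ^ (2 * η) := by rw [e3, hD]; ring
    -- At `t = 0` the kernel is only a default value; it is multiplied by `b 0 = 0`.
    · rw [hp.zero, mul_zero, norm_zero]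
      positivity

theorem mainTheorem7 {Ω : Type*} [MeasurableSpace Ω] (P : Measure Ω) [IsProbabilityMeasure P]
    (B : ℝ → Ω → ℝ) (hB : IsTwoSidedBrownian B P) (n : ℕ) :
    ∀ᵐ ω ∂P,
      (∀ H ∈ Ioo (0 : ℝ) 1, ∀ t ∈ Ici (0 : ℝ),
        IntegrableOn (pwzNegIntegrand (fun s => B s ω) n H t) (Iio 0) ∧
        IntegrableOn (pwzPosIntegrand (fun s => B s ω) n H t) (Ioo 0 t)) ∧
      ContinuousOn (fun p : ℝ × ℝ => pwzField (fun s => B s ω) n p.1 p.2)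
        (Ioo (0 : ℝ) 1 ×ˢ Ici (0 : ℝ)) := by
  filter_upwards [hB.pos.ae_isHolderHalfPath,
    IsBrownianReal.ae_isHolderHalfPath (B := fun s => B (-s)) hB.neg] with ω hp hn
  have hb : Continuous fun s => B s ω := by
    have h1 : ContinuousOn (fun s => B s ω) (Iic 0) := by
      have := hn.cont.comp (continuous_neg.continuousOn (s := Iic (0 : ℝ)))
        (fun x hx => by simpa using hx)
      simpa [Function.comp_def] using this
    rw [← continuousOn_univ, ← Iic_union_Ici (a := (0 : ℝ))]
    exact h1.union_of_isClosed hp.cont isClosed_Iic isClosed_Ici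
  refine ⟨fun H hH t ht => ⟨integrableOn_pwzNegIntegrand hb hn n hH ht,
    integrableOn_pwzPosIntegrand hb hp n hH ht⟩, fun p hpp => ?_⟩
  exact ((continuousWithinAt_pwzNegIntegral hb hn n hpp).neg.add
    (continuousWithinAt_gKerD_mul hb hp n hpp)).add (continuousWithinAt_pwzPosIntegral hb hp n hpp)
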